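/- Let $F$ be an infinite perfect field of characteristic $p>2$ and let $n\ge 1$ be an integer with $p^n\neq 3$. Let $O(1:n)$ be the divided power algebra over $F$ with basis $x^{(i)}$ $(0\le i<p^n)$ and product $x^{(i)}x^{(j)}=\binom{i+j}{i}x^{(i+j)}$ (read as $0$ if $i+j\ge p^n$), let $\partial$ be its derivation with $\partial x^{(0)}=0$ and $\partial x^{(i+1)}=x^{(i)}$, let $W(1:n)=\{f\partial : f\in O(1:n)\}$ be the Zassenhaus algebra, a Lie algebra under the commutator of derivations, and let $W(1:n)_0=\{f\partial : f \text{ has zero constant term}\}$ be its standard maximal subalgebra. For subalgebras $U,B$ of a Lie algebra $L$ let $\langle U,B\rangle$ be the subalgebra generated by $U$ and $B$; say that $B$ covers $A$ if $A$ is a maximal (proper) subalgebra of $B$. A subalgebra $U$ of $L$ is called semi-modular (sm) in $L$ if, for every subalgebra $B$ of $L$, $\langle U,B\rangle$ covers $U$ if and only if $B$ covers $U\cap B$. Then $W(1:n)_0$ is the unique proper non-zero semi-modular subalgebra of $W(1:n)$; that is, a subalgebra $U$ of $W(1:n)$ satisfies $0\neq U\neq W(1:n)$ and is semi-modular in $W(1:n)$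 if and only if $U=W(1:n)_0$. -/

import Mathlib

/-! ### Semi-modular subalgebras -/

section Semimodular

variable {R L : Type*} [CommRing R] [LieRing L] [LieAlgebra R L]

/-- `U` is upper modular: whenever `B` covers `U ∩ B`, the subalgebra `⟨U, B⟩` covers `U`. -/
def LieSubalgebra.IsUpperModular (U : LieSubalgebra R L) : Prop :=
  ∀ B : LieSubalgebra R L, U ⊓ B ⋖ B → U ⋖ U ⊔ B

/-- `U` is lower modular: whenever `⟨U, B⟩` covers `U`, the subalgebra `B` covers `U ∩ B`. -/
def LieSubalgebra.IsLowerModular (U : LieSubalgebra R L) : Prop :=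
  ∀ B : LieSubalgebra R L, U ⋖ U ⊔ B → U ⊓ B ⋖ B

/-- `U` is semi-modular: it is both upper and lower modular. -/
def LieSubalgebra.IsSemiModular (U : LieSubalgebra R L) : Prop :=
  U.IsUpperModular ∧ U.IsLowerModular

end Semimodular

/-! ### Truncated divided power algebras -/

/-- The divided power algebra in one variable truncated at `q`: the function `f` stands for
`∑ i < q, f i • x^(i)`, and `x^(i) * x^(j) = (i + j).choose i • x^(i+j)`, which is zero
if `q ≤ i + j`. For `q = p ^ n` in characteristic `p` the binomial coefficient itself vanishes if
`i, j < q ≤ i + j`, so that this is the subalgebra `O(1:n)` of the full divided power algebra. -/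
def TruncDividedPower (F : Type*) (q : ℕ) : Type _ := Fin q → F

namespace TruncDividedPower

variable {F : Type*} [Field F] {q : ℕ}

instance : AddCommGroup (TruncDividedPower F q) := inferInstanceAs (AddCommGroup (Fin q → F))

instance : Module F (TruncDividedPower F q) := inferInstanceAs (Module F (Fin q → F))

/-- The coefficient of `x^(i)`, which is zero if `q ≤ i`. -/
def coeff (f : TruncDividedPower F q) (i : ℕ) : F := if h : i < q then f ⟨i, h⟩ else 0

/-- The element whose coefficient at `x^(i)` is `a i` for each `i < q`. -/
def mk (q : ℕ) (a : ℕ → F) : TruncDividedPower F q := fun i => a i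

theorem coeff_mk (a : ℕ → F) {i : ℕ} (h : i < q) : (mk q a).coeff i = a i := by
  simp [coeff, mk, h]

theorem coeff_of_le (f : TruncDividedPower F q) {i : ℕ} (h : q ≤ i) : f.coeff i = 0 := by
  simp [coeff, Nat.not_lt.2 h]

theorem ext_coeff {f g : TruncDividedPower F q} (h : ∀ i < q, f.coeff i = g.coeff i) : f = g := by
  funext i
  simpa [coeff] using h i i.2

theorem coeff_add (f g : TruncDividedPower F q) (i : ℕ) :
    (f + g).coeff i = f.coeff i + g.coeff i := by
  unfold coeff
  split_ifs
  · rfl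
  · simp

theorem coeff_smul (c : F) (f : TruncDividedPower F q) (i : ℕ) :
    (c • f).coeff i = c * f.coeff i := by
  unfold coeff
  split_ifs
  · rfl
  · simp

theorem coeff_zero (i : ℕ) : (0 : TruncDividedPower F q).coeff i = 0 := by
  unfold coeff
  split_ifs <;> rfl

instance : One (TruncDividedPower F q) := ⟨mk q fun i => if i = 0 then 1 else 0⟩

instance : Mul (TruncDividedPower F q) :=
  ⟨fun f g => mk q fun k =>
    ∑ ij ∈ Finset.HasAntidiagonal.antidiagonal k, (k.choose ij.1 : F) * (f.coeff ij.1 * g.coeff ij.2)⟩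

theorem coeff_one {i : ℕ} (h : i < q) :
    (1 : TruncDividedPower F q).coeff i = if i = 0 then 1 else 0 :=
  coeff_mk _ h

theorem coeff_mul (f g : TruncDividedPower F q) {k : ℕ} (h : k < q) :
    (f * g).coeff k =
      ∑ ij ∈ Finset.HasAntidiagonal.antidiagonal k, (k.choose ij.1 : F) * (f.coeff ij.1 * g.coeff ij.2) :=
  coeff_mk _ h

protected theorem mul_comm' (f g : TruncDividedPower F q) : f * g = g * f := by
  refine TruncDividedPower.ext_coeff fun k hk => ?_
  rw [coeff_mul _ _ hk, coeff_mul _ _ hk, ← Finset.Nat.sum_antidiagonal_swap]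
  refine Finset.sum_congr rfl fun ij hij => ?_
  rw [Finset.HasAntidiagonal.mem_antidiagonal] at hij
  simp only [Prod.fst_swap, Prod.snd_swap]
  rw [Nat.choose_symm_of_eq_add (by omega : k = ij.2 + ij.1), mul_comm (f.coeff _)]

protected theorem mul_assoc' (f g h : TruncDividedPower F q) : f * g * h = f * (g * h) := by
  refine TruncDividedPower.ext_coeff fun k hk => ?_
  rw [coeff_mul _ _ hk, coeff_mul _ _ hk]
  have e1 : ∀ ij ∈ Finset.HasAntidiagonal.antidiagonal k,
      (k.choose ij.1 : F) * ((f * g).coeff ij.1 * h.coeff ij.2) =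
        ∑ ab ∈ Finset.HasAntidiagonal.antidiagonal ij.1, (k.choose ij.1 : F) * (ij.1.choose ab.1 : F) *
          (f.coeff ab.1 * g.coeff ab.2 * h.coeff ij.2) := by
    intro ij hij
    rw [Finset.HasAntidiagonal.mem_antidiagonal] at hij
    rw [coeff_mul _ _ (by omega), Finset.sum_mul, Finset.mul_sum]
    exact Finset.sum_congr rfl fun _ _ => by ring
  have e2 : ∀ ij ∈ Finset.HasAntidiagonal.antidiagonal k,
      (k.choose ij.1 : F) * (f.coeff ij.1 * (g * h).coeff ij.2) =
        ∑ ab ∈ Finset.HasAntidiagonal.antidiagonal ij.2, (k.choose ij.1 : F) * (ij.2.choose ab.1 : F) *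
          (f.coeff ij.1 * g.coeff ab.1 * h.coeff ab.2) := by
    intro ij hij
    rw [Finset.HasAntidiagonal.mem_antidiagonal] at hij
    rw [coeff_mul _ _ (by omega), Finset.mul_sum, Finset.mul_sum]
    exact Finset.sum_congr rfl fun _ _ => by ring
  rw [Finset.sum_congr rfl e1, Finset.sum_congr rfl e2, Finset.sum_sigma', Finset.sum_sigma']
  refine Finset.sum_bij' (fun s _ => ⟨(s.2.1, s.2.2 + s.1.2), (s.2.2, s.1.2)⟩)
    (fun s _ => ⟨(s.1.1 + s.2.1, s.2.2), (s.1.1, s.2.1)⟩) ?_ ?_ ?_ ?_ ?_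
  · rintro ⟨⟨a, c⟩, ⟨i, j⟩⟩ hs
    simp only [Finset.mem_sigma, Finset.HasAntidiagonal.mem_antidiagonal] at hs ⊢
    exact ⟨by omega, trivial⟩
  · rintro ⟨⟨a, c⟩, ⟨i, j⟩⟩ hs
    simp only [Finset.mem_sigma, Finset.HasAntidiagonal.mem_antidiagonal] at hs ⊢
    exact ⟨by omega, trivial⟩
  · rintro ⟨⟨a, c⟩, ⟨i, j⟩⟩ hs
    simp only [Finset.mem_sigma, Finset.HasAntidiagonal.mem_antidiagonal] at hs ⊢
    obtain ⟨-, rfl⟩ := hs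
    rfl
  · rintro ⟨⟨a, c⟩, ⟨i, j⟩⟩ hs
    simp only [Finset.mem_sigma, Finset.HasAntidiagonal.mem_antidiagonal] at hs ⊢
    obtain ⟨-, rfl⟩ := hs
    rfl
  · rintro ⟨⟨a, c⟩, ⟨i, j⟩⟩ hs
    simp only [Finset.mem_sigma, Finset.HasAntidiagonal.mem_antidiagonal] at hs ⊢
    obtain ⟨rfl, rfl⟩ := hs
    have := Nat.choose_mul (n := i + j + c) (k := i + j) (s := i) (by omega)
    rw [show i + j + c - i = j + c by omega, show i + j - i = j by omega] at this
    rw [← Nat.cast_mul, ← Nat.cast_mul, this]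

protected theorem one_mul' (f : TruncDividedPower F q) : 1 * f = f := by
  refine TruncDividedPower.ext_coeff fun k hk => ?_
  rw [coeff_mul _ _ hk, Finset.sum_eq_single (0, k)]
  · simp [coeff_one (show 0 < q by omega)]
  · rintro ⟨i, j⟩ hij hne
    rw [Finset.HasAntidiagonal.mem_antidiagonal] at hij
    have : i ≠ 0 := by
      rintro rfl
      exact hne (by simp_all)
    simp only at hij
    rw [coeff_one (by omega)]
    simp [this]
  · simp

protected theorem left_distrib' (f g h : TruncDividedPower F q) :
    f * (g + h) = f * g + f * h := by
  refine TruncDividedPower.ext_coeff fun k hk => ?_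
  rw [coeff_add, coeff_mul _ _ hk, coeff_mul _ _ hk, coeff_mul _ _ hk, ← Finset.sum_add_distrib]
  exact Finset.sum_congr rfl fun _ _ => by rw [coeff_add]; ring

protected theorem smul_mul' (c : F) (f g : TruncDividedPower F q) :
    c • f * g = c • (f * g) := by
  refine TruncDividedPower.ext_coeff fun k hk => ?_
  rw [coeff_smul, coeff_mul _ _ hk, coeff_mul _ _ hk, Finset.mul_sum]
  exact Finset.sum_congr rfl fun _ _ => by rw [coeff_smul]; ring

instance : CommRing (TruncDividedPower F q) where
  __ := (inferInstance : AddCommGroup (TruncDividedPower F q))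
  mul_assoc := TruncDividedPower.mul_assoc'
  mul_comm := TruncDividedPower.mul_comm'
  one_mul := TruncDividedPower.one_mul'
  mul_one f := by rw [TruncDividedPower.mul_comm', TruncDividedPower.one_mul']
  left_distrib := TruncDividedPower.left_distrib'
  right_distrib f g h := by
    rw [TruncDividedPower.mul_comm', TruncDividedPower.left_distrib',
      TruncDividedPower.mul_comm' h, TruncDividedPower.mul_comm' h]
  zero_mul f := by
    have := TruncDividedPower.smul_mul' (0 : F) 0 f
    simpa using this
  mul_zero f := by
    have := TruncDividedPower.smul_mul' (0 : F) 0 f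
    rw [TruncDividedPower.mul_comm']
    simpa using this

instance : Algebra F (TruncDividedPower F q) :=
  Algebra.ofModule TruncDividedPower.smul_mul' fun c f g => by
    rw [TruncDividedPower.mul_comm', TruncDividedPower.smul_mul', TruncDividedPower.mul_comm']

end TruncDividedPower

/-! ### Zassenhaus algebras -/

namespace Zassenhaus

open TruncDividedPower

variable (F : Type*) [Field F] (p n : ℕ) [Fact p.Prime] [CharP F p]

/-- The derivation `∂` of `O(1:n)` with `∂ x^(0) = 0` and `∂ x^(i+1) = x^(i)`. -/
def del : Derivation F (TruncDividedPower F (p ^ n)) (TruncDividedPower F (p ^ n)) :=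
  Derivation.mk'
    { toFun := fun f => mk (p ^ n) fun i => f.coeff (i + 1)
      map_add' := fun f g => ext_coeff fun i hi => by
        simp only [coeff_add, coeff_mk _ hi]
      map_smul' := fun c f => ext_coeff fun i hi => by
        simp only [coeff_smul, coeff_mk _ hi, RingHom.id_apply] }
    (fun f g => ext_coeff fun k hk => by
      have key : (mk (p ^ n) fun i => (f * g).coeff (i + 1)).coeff k =
          ∑ ij ∈ Finset.HasAntidiagonal.antidiagonal (k + 1),
            ((k + 1).choose ij.1 : F) * (f.coeff ij.1 * g.coeff ij.2) := by
        rw [coeff_mk _ hk]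
        rcases Nat.lt_or_ge (k + 1) (p ^ n) with h | h
        · exact coeff_mul _ _ h
        · rw [coeff_of_le _ h]
          refine (Finset.sum_eq_zero fun ij hij => ?_).symm
          rw [Finset.HasAntidiagonal.mem_antidiagonal] at hij
          have hk1 : k + 1 = p ^ n := by omega
          by_cases h1 : ij.1 = 0
          · rw [coeff_of_le g (by omega)]; ring
          · by_cases h2 : ij.2 = 0
            · rw [coeff_of_le f (by omega)]; ring
            · have hd : p ∣ (k + 1).choose ij.1 := by
                rw [hk1]
                exact (Fact.out : p.Prime).dvd_choose_pow h1 (by omega)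
              rw [(CharP.cast_eq_zero_iff F p _).2 hd]; ring
      simp only [LinearMap.coe_mk, AddHom.coe_mk, smul_eq_mul]
      rw [key, coeff_add, coeff_mul _ _ hk, coeff_mul _ _ hk,
        Finset.sum_antidiagonal_choose_succ_mul
          (fun i j => f.coeff i * g.coeff j) k]
      congr 1
      · refine Finset.sum_congr rfl fun ij hij => ?_
        rw [Finset.HasAntidiagonal.mem_antidiagonal] at hij
        rw [coeff_mk _ (by omega)]
      · rw [← Finset.Nat.sum_antidiagonal_swap]
        refine Finset.sum_congr rfl fun ij hij => ?_
        rw [Finset.HasAntidiagonal.mem_antidiagonal] at hij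
        simp only [Prod.fst_swap, Prod.snd_swap]
        rw [coeff_mk _ (by omega)]
        ring)

theorem coeff_del (f : TruncDividedPower F (p ^ n)) (i : ℕ) :
    (del F p n f).coeff i = f.coeff (i + 1) := by
  rcases Nat.lt_or_ge i (p ^ n) with h | h
  · exact coeff_mk (fun i => f.coeff (i + 1)) h
  · rw [coeff_of_le _ h, coeff_of_le f (by omega)]

theorem lie_smul_del (f g : TruncDividedPower F (p ^ n)) :
    ⁅f • del F p n, g • del F p n⁆ = (f * del F p n g - g * del F p n f) • del F p n := by
  ext h
  simp only [Derivation.commutator_apply, Derivation.smul_apply, Derivation.leibniz, smul_eq_mul]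
  ring

/-- The Zassenhaus algebra `W(1:n)`: the Lie algebra of all derivations `f ∂` of `O(1:n)`
with `f` in `O(1:n)`. -/
def W : LieSubalgebra F
    (Derivation F (TruncDividedPower F (p ^ n)) (TruncDividedPower F (p ^ n))) where
  carrier := {D | ∃ f : TruncDividedPower F (p ^ n), D = f • del F p n}
  zero_mem' := ⟨0, (zero_smul _ _).symm⟩
  add_mem' := by
    rintro _ _ ⟨f, rfl⟩ ⟨g, rfl⟩
    exact ⟨f + g, (add_smul _ _ _).symm⟩
  smul_mem' := by
    rintro c _ ⟨f, rfl⟩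
    exact ⟨c • f, (smul_assoc _ _ _).symm⟩
  lie_mem' := by
    rintro _ _ ⟨f, rfl⟩ ⟨g, rfl⟩
    exact ⟨_, lie_smul_del F p n f g⟩

/-- The standard maximal subalgebra `W(1:n)₀`: all `f ∂` such that `f` has no constant term,
that is, the span of the `x^(i+1) ∂` with `0 ≤ i ≤ p ^ n - 2`. -/
def W₀ : LieSubalgebra F (W F p n) where
  carrier := {D | ∃ f : TruncDividedPower F (p ^ n), f.coeff 0 = 0 ∧ D.1 = f • del F p n}
  zero_mem' := ⟨0, coeff_zero 0, (zero_smul _ _).symm⟩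
  add_mem' := by
    rintro ⟨_, _⟩ ⟨_, _⟩ ⟨f, hf, rfl⟩ ⟨g, hg, rfl⟩
    exact ⟨f + g, by rw [coeff_add, hf, hg, add_zero], (add_smul _ _ _).symm⟩
  smul_mem' := by
    rintro c ⟨_, _⟩ ⟨f, hf, rfl⟩
    exact ⟨c • f, by rw [coeff_smul, hf, mul_zero], (smul_assoc _ _ _).symm⟩
  lie_mem' := by
    rintro ⟨_, _⟩ ⟨_, _⟩ ⟨f, hf, rfl⟩ ⟨g, hg, rfl⟩
    refine ⟨_, ?_, lie_smul_del F p n f g⟩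
    have hq : 0 < p ^ n := pow_pos (Fact.out : p.Prime).pos n
    rw [sub_eq_add_neg, ← neg_one_smul F (g * _), coeff_add, coeff_smul, coeff_mul _ _ hq,
      coeff_mul _ _ hq]
    simp [hf, hg]

end Zassenhaus

/-! Write `q = p ^ n`, and call the least index of a nonzero coefficient of `f` its order. `W₀` has
codimension one, and any such subalgebra is semi-modular, since it meets every subalgebra not inside
it in codimension one.

Conversely, let `U` be proper and semi-modular, and let `e = x^(q-1) ∂`. Suppose `U` is not inside
`W₀`. Bracketing with an element outside `W₀` lowers positive orders by one, so `U` and `e` generate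
everything. Thus `e ∉ U`, and `U` is maximal by upper modularity. Lower modularity then puts `x^(2)
∂ + c e` and `x^(q-2) ∂ + d e` in `U`, because both leading terms commute with `e` when `q ≥ 5`.
Their bracket is `2 e`, a contradiction (`le_W₀_of_isSemiModular`).

Now suppose `0 ≠ U ≤ W₀`. For `y ∉ W₀`, the subalgebra `⟨U, y⟩` covers `U`, hence meets `W₀` exactly
in `U`. This closure property yields elements of `U` of every order from `1` to `q - 1`, so `U = W₀`
(`W₀_le_of_isUpperModular`). -/

/-! ### Covering arguments in an arbitrary Lie algebra over a field -/

section Semimodular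

variable {R L : Type*} [Field R] [LieRing L] [LieAlgebra R L]

/-- The subalgebra spanned by two commuting elements. -/
def LieSubalgebra.spanPair (a b : L) (h : ⁅a, b⁆ = 0) : LieSubalgebra R L where
  __ := Submodule.span R {a, b}
  lie_mem' := by
    intro x y hx hy
    obtain ⟨s, t, rfl⟩ := Submodule.mem_span_pair.1 hx
    obtain ⟨s', t', rfl⟩ := Submodule.mem_span_pair.1 hy
    have h' : ⁅b, a⁆ = 0 := by rw [← lie_skew, h, neg_zero]
    have : ⁅s • a + t • b, s' • a + t' • b⁆ = 0 := by simp [h, h']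
    rw [this]
    exact Submodule.zero_mem _

theorem LieSubalgebra.mem_spanPair {a b : L} {h : ⁅a, b⁆ = 0} {x : L} :
    x ∈ LieSubalgebra.spanPair (R := R) a b h ↔ ∃ s t : R, s • a + t • b = x :=
  Submodule.mem_span_pair

/-- The subalgebra spanned by one element. -/
def LieSubalgebra.spanSingleton (a : L) : LieSubalgebra R L where
  __ := Submodule.span R {a}
  lie_mem' := by
    intro x y hx hy
    obtain ⟨s, rfl⟩ := Submodule.mem_span_singleton.1 hx
    obtain ⟨s', rfl⟩ := Submodule.mem_span_singleton.1 hy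
    have : ⁅s • a, s' • a⁆ = 0 := by simp
    rw [this]
    exact Submodule.zero_mem _

theorem LieSubalgebra.mem_spanSingleton {a x : L} :
    x ∈ LieSubalgebra.spanSingleton (R := R) a ↔ ∃ s : R, s • a = x :=
  Submodule.mem_span_singleton

/-- An upper modular subalgebra is covered by the subalgebra generated by it and one element. -/
theorem LieSubalgebra.IsUpperModular.covBy_sup_spanSingleton {U : LieSubalgebra R L}
    (hU : U.IsUpperModular) {x : L} (hx : x ∉ U) :
    U ⋖ U ⊔ LieSubalgebra.spanSingleton x := by
  have hmem : x ∈ LieSubalgebra.spanSingleton (R := R) x := mem_spanSingleton.2 ⟨1, one_smul _ _⟩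
  refine hU _ ⟨lt_of_le_of_ne inf_le_right fun h => hx ?_, fun C hC hCx => ?_⟩
  · rw [← h] at hmem
    exact hmem.1
  · obtain ⟨y, hy, hyU⟩ := SetLike.exists_of_lt hC
    obtain ⟨s, rfl⟩ := mem_spanSingleton.1 (hCx.le hy)
    have hs : s ≠ 0 := by
      rintro rfl
      exact hyU (by rw [zero_smul]; exact zero_mem _)
    refine hCx.not_ge fun z hz => ?_
    obtain ⟨t, rfl⟩ := mem_spanSingleton.1 hz
    have := C.smul_mem (t * s⁻¹) hy
    rwa [smul_smul, inv_mul_cancel_right₀ hs] at this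

/-- A lower modular maximal subalgebra meets every plane spanned by commuting elements. -/
theorem LieSubalgebra.IsLowerModular.exists_add_smul_mem {U : LieSubalgebra R L}
    (hU : U.IsLowerModular) (hmax : U ⋖ ⊤) {a e : L} (he : e ∉ U) (hae : ⁅a, e⁆ = 0) :
    ∃ c : R, a + c • e ∈ U := by
  set B := LieSubalgebra.spanPair (R := R) a e hae with hB
  have heB : e ∈ B := mem_spanPair.2 ⟨0, 1, by simp⟩
  have haB : a ∈ B := mem_spanPair.2 ⟨1, 0, by simp⟩
  have hsup : U ⊔ B = ⊤ := (hmax.eq_or_eq le_sup_left le_top).resolve_left fun h =>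
    he (h ▸ (le_sup_right : B ≤ U ⊔ B) heB)
  have hcov : U ⊓ B ⋖ B := hU B (hsup ▸ hmax)
  -- A nonzero `s • a + t • e` in `U` has `s ≠ 0` because `e ∉ U`. If `U ⊓ B` is zero, then `B`
  -- covers zero and is the line through `e`, so `a` is a multiple of `e`.
  by_cases h : ∃ y ∈ U ⊓ B, y ≠ 0
  · obtain ⟨y, ⟨hyU, hyB⟩, hy0⟩ := h
    obtain ⟨s, t, rfl⟩ := mem_spanPair.1 hyB
    have hs : s ≠ 0 := by
      rintro rfl
      have ht : t ≠ 0 := by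
        rintro rfl
        simp at hy0
      refine he ?_
      have := U.smul_mem t⁻¹ hyU
      rwa [zero_smul, zero_add, smul_smul, inv_mul_cancel₀ ht, one_smul] at this
    refine ⟨s⁻¹ * t, ?_⟩
    have := U.smul_mem s⁻¹ hyU
    rwa [smul_add, smul_smul, smul_smul, inv_mul_cancel₀ hs, one_smul] at this
  · push Not at h
    have hle : LieSubalgebra.spanSingleton (R := R) e ≤ B := fun x hx => by
      obtain ⟨s, rfl⟩ := mem_spanSingleton.1 hx
      exact B.smul_mem s heB
    have hem : e ∈ LieSubalgebra.spanSingleton (R := R) e :=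
      mem_spanSingleton.2 ⟨1, one_smul _ _⟩
    have hge : U ⊓ B ≤ LieSubalgebra.spanSingleton (R := R) e := fun x hx => by
      rw [h x hx]
      exact zero_mem _
    rcases hcov.eq_or_eq hge hle with h1 | h1
    · rw [h1] at hem
      exact absurd hem.1 he
    · rw [← h1] at haB
      obtain ⟨s, rfl⟩ := mem_spanSingleton.1 haB
      exact ⟨-s, by simp⟩

/-- A subalgebra of codimension at most one is semi-modular. -/
theorem LieSubalgebra.isSemiModular_of_codim_le_one {U : LieSubalgebra R L}
    (hU : ∀ x y, y ∉ U → ∃ c : R, x - c • y ∈ U) : U.IsSemiModular := by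
  have key : ∀ C : LieSubalgebra R L, ¬ C ≤ U → U ⊓ C ⋖ C := by
    refine fun C hC => ⟨lt_of_le_of_ne inf_le_right fun h => hC (inf_eq_right.1 h),
      fun A hA hAC => hAC.not_ge fun x hx => ?_⟩
    obtain ⟨y, hy, hyU⟩ := SetLike.exists_of_lt hA
    obtain ⟨c, hc⟩ := hU x y fun h => hyU ⟨h, hAC.le hy⟩
    have h1 : x - c • y ∈ A := hA.le ⟨hc, C.sub_mem hx (C.smul_mem c (hAC.le hy))⟩
    simpa using A.add_mem h1 (A.smul_mem c hy)
  refine ⟨fun B hB => ?_, fun B hB => key B fun h => ?_⟩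
  · have := key (U ⊔ B) fun h => hB.lt.ne (inf_eq_right.2 (le_sup_right.trans h))
    rwa [inf_eq_left.2 le_sup_left] at this
  · rw [sup_eq_left.2 h] at hB
    exact hB.lt.false

end Semimodular

/-! ### Orders of divided power elements -/

namespace TruncDividedPower

variable {F : Type*} [Field F] {q : ℕ}

theorem coeff_sub (f g : TruncDividedPower F q) (i : ℕ) :
    (f - g).coeff i = f.coeff i - g.coeff i := by
  rw [sub_eq_add_neg, ← neg_one_smul F g, coeff_add, coeff_smul]
  ring

/-- The basis element `x^(k)`. -/
def basisElem (F : Type*) [Field F] (q k : ℕ) : TruncDividedPower F q :=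
  mk q fun i => if i = k then 1 else 0

theorem coeff_basisElem {k i : ℕ} (h : i < q) :
    (basisElem F q k).coeff i = if i = k then 1 else 0 :=
  coeff_mk _ h

theorem coeff_basisElem_self {k : ℕ} (h : k < q) : (basisElem F q k).coeff k = 1 := by
  simp [coeff_basisElem h]

theorem coeff_basisElem_of_ne {k i : ℕ} (h : i ≠ k) : (basisElem F q k).coeff i = 0 := by
  rcases Nat.lt_or_ge i q with hi | hi
  · simp [coeff_basisElem hi, h]
  · exact coeff_of_le _ hi

theorem coeff_mul_of_lt {f g : TruncDividedPower F q} {a b k : ℕ}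
    (hf : ∀ i < a, f.coeff i = 0) (hg : ∀ i < b, g.coeff i = 0) (hk : k < a + b) :
    (f * g).coeff k = 0 := by
  rcases Nat.lt_or_ge k q with h | h
  · rw [coeff_mul _ _ h]
    refine Finset.sum_eq_zero fun ij hij => ?_
    rw [Finset.HasAntidiagonal.mem_antidiagonal] at hij
    rcases Nat.lt_or_ge ij.1 a with h1 | h1
    · rw [hf _ h1]; ring
    · rw [hg ij.2 (by omega)]; ring
  · exact coeff_of_le _ h

/-- Only the pair `(a, b)` survives in the convolution. The binomial factor may vanish in `F`, so
orders need not add exactly. -/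
theorem coeff_mul_of_eq {f g : TruncDividedPower F q} {a b k : ℕ}
    (hf : ∀ i < a, f.coeff i = 0) (hg : ∀ i < b, g.coeff i = 0) (hk : k = a + b) (h : k < q) :
    (f * g).coeff k = (k.choose a : F) * (f.coeff a * g.coeff b) := by
  rw [coeff_mul _ _ h, Finset.sum_eq_single (a, b)]
  · rintro ⟨i, j⟩ hij hne
    rw [Finset.HasAntidiagonal.mem_antidiagonal] at hij
    simp only at hij
    rcases Nat.lt_trichotomy i a with h1 | h1 | h1
    · rw [hf _ h1]; ring
    · exact absurd (Prod.ext h1 (by simp only; omega)) hne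
    · rw [hg j (by omega)]; ring
  · intro h1
    exact absurd (Finset.HasAntidiagonal.mem_antidiagonal.2 hk.symm) h1

/-- A subspace containing elements of each order `k` with `m ≤ k < q` contains all elements of
order at least `m`. -/
theorem mem_of_exists_order {S : Submodule F (TruncDividedPower F q)} {m : ℕ}
    (hS : ∀ k, m ≤ k → k < q → ∃ f ∈ S, f.coeff k ≠ 0 ∧ ∀ i < k, f.coeff i = 0)
    {f : TruncDividedPower F q} (hf : ∀ i < m, f.coeff i = 0) : f ∈ S := by
  induction h : q - m generalizing m f with
  | zero =>
    have : f = 0 := ext_coeff fun i hi => by rw [hf i (by omega), coeff_zero]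
    rw [this]
    exact S.zero_mem
  | succ d ih =>
    obtain ⟨g, hgS, hgm, hg⟩ := hS m le_rfl (by omega)
    -- Elimination of the leading term: the difference has order at least `m + 1`.
    have h1 : f - (f.coeff m / g.coeff m) • g ∈ S := by
      refine ih (m := m + 1) (fun k hk => hS k (by omega)) (fun i hi => ?_) (by omega)
      rw [coeff_sub, coeff_smul]
      rcases Nat.lt_succ_iff_lt_or_eq.1 hi with hi | rfl
      · rw [hf i hi, hg i hi]; ring
      · rw [div_mul_cancel₀ _ hgm, sub_self]
    simpa using S.add_mem h1 (S.smul_mem (f.coeff m / g.coeff m) hgS)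

end TruncDividedPower

/-! ### The Zassenhaus algebra and its standard subalgebra -/

namespace Zassenhaus

open TruncDividedPower

theorem two_lt_pow (p : ℕ) {n : ℕ} (hp : 2 < p) (hn : 0 < n) : 2 < p ^ n :=
  hp.trans_le (Nat.le_self_pow hn.ne' p)

variable (F : Type*) [Field F] (p n : ℕ) [Fact p.Prime] [CharP F p]

/-- The map taking `f` to `f ∂`. -/
def toW : TruncDividedPower F (p ^ n) →ₗ[F] W F p n where
  toFun f := ⟨f • del F p n, f, rfl⟩
  map_add' f g := Subtype.ext (add_smul f g (del F p n))
  map_smul' c f := Subtype.ext (smul_assoc c f (del F p n))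

theorem toW_surjective : Function.Surjective (toW F p n) := by
  rintro ⟨_, f, rfl⟩
  exact ⟨f, rfl⟩

theorem lie_toW (f g : TruncDividedPower F (p ^ n)) :
    ⁅toW F p n f, toW F p n g⁆ = toW F p n (f * del F p n g - g * del F p n f) :=
  Subtype.ext (lie_smul_del F p n f g)

variable {n}

/-- Evaluation at `x^(1)` recovers `f`, since `∂ x^(1) = 1`. -/
theorem smul_del_injective (hq : 2 < p ^ n) {f g : TruncDividedPower F (p ^ n)}
    (h : f • del F p n = g • del F p n) : f = g := by
  have h1 : del F p n (basisElem F (p ^ n) 1) = 1 := ext_coeff fun i hi => by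
    rw [coeff_del, coeff_one hi]
    split_ifs with h0
    · rw [h0, coeff_basisElem_self (by omega)]
    · exact coeff_basisElem_of_ne (by omega)
  have := DFunLike.congr_fun h (basisElem F (p ^ n) 1)
  simpa [Derivation.smul_apply, h1] using this

variable {F p}

theorem toW_mem_W₀ (hq : 2 < p ^ n) {f : TruncDividedPower F (p ^ n)} :
    toW F p n f ∈ W₀ F p n ↔ f.coeff 0 = 0 := by
  constructor
  · rintro ⟨g, hg, h⟩
    rwa [smul_del_injective F p hq h]
  · exact fun h => ⟨f, h, rfl⟩

theorem W₀_isSemiModular (hq : 2 < p ^ n) : (W₀ F p n).IsSemiModular := by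
  refine LieSubalgebra.isSemiModular_of_codim_le_one fun x y hy => ?_
  obtain ⟨f, rfl⟩ := toW_surjective F p n x
  obtain ⟨g, rfl⟩ := toW_surjective F p n y
  rw [toW_mem_W₀ hq] at hy
  refine ⟨f.coeff 0 / g.coeff 0, ?_⟩
  rw [← map_smul, ← map_sub, toW_mem_W₀ hq, coeff_sub, coeff_smul, div_mul_cancel₀ _ hy, sub_self]

theorem W₀_ne_bot (hq : 2 < p ^ n) : W₀ F p n ≠ ⊥ := by
  intro h
  have h1 : toW F p n (basisElem F (p ^ n) 1) ∈ W₀ F p n :=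
    (toW_mem_W₀ hq).2 (coeff_basisElem_of_ne (by omega))
  rw [h, LieSubalgebra.mem_bot] at h1
  have h2 := smul_del_injective F p hq
    (show basisElem F (p ^ n) 1 • del F p n = (0 : TruncDividedPower F (p ^ n)) • del F p n from
      (congrArg Subtype.val h1).trans (zero_smul _ _).symm)
  have h3 := coeff_basisElem_self (F := F) (show 1 < p ^ n by omega)
  rw [h2, coeff_zero] at h3
  exact zero_ne_one h3

theorem W₀_ne_top (hq : 2 < p ^ n) : W₀ F p n ≠ ⊤ := by
  intro h
  have h1 : toW F p n 1 ∈ W₀ F p n := h ▸ LieSubalgebra.mem_top _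
  rw [toW_mem_W₀ hq, coeff_one (by omega)] at h1
  simp at h1

/-! ### Determination of the semi-modular subalgebras -/

/-- A subalgebra with an element outside `W(1:n)₀` and with `x^(q-1) ∂` is everything. -/
theorem eq_top_of_mem (U : LieSubalgebra F (W F p n)) {u : TruncDividedPower F (p ^ n)}
    (hu : toW F p n u ∈ U) (hu0 : u.coeff 0 ≠ 0)
    (he : toW F p n (basisElem F (p ^ n) (p ^ n - 1)) ∈ U) : U = ⊤ := by
  have hq : 0 < p ^ n := pow_pos (Fact.out : p.Prime).pos n
  have hS : ∀ d < p ^ n, ∃ f ∈ U.toSubmodule.comap (toW F p n),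
      f.coeff (p ^ n - 1 - d) ≠ 0 ∧ ∀ i < p ^ n - 1 - d, f.coeff i = 0 := by
    intro d hd
    induction d with
    | zero =>
      refine ⟨_, he, ?_, fun i hi => coeff_basisElem_of_ne (by omega)⟩
      rw [Nat.sub_zero, coeff_basisElem_self (by omega)]
      exact one_ne_zero
    | succ d ih =>
      obtain ⟨f, hf, hfd, hfi⟩ := ih (by omega)
      obtain ⟨k, hk⟩ : ∃ k, p ^ n - 1 - d = k + 1 := ⟨p ^ n - 1 - (d + 1), by omega⟩
      have hk' : p ^ n - 1 - (d + 1) = k := by omega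
      rw [hk] at hfd hfi
      rw [hk']
      -- For `f` of order `k + 1`, the term `u * ∂ f` has leading coefficient `u_0 f_{k+1}` at `k`,
      -- while `f * ∂ u` has order at least `k + 1`.
      refine ⟨u * del F p n f - f * del F p n u, ?_, ?_, fun i hi => ?_⟩
      · have := U.lie_mem hu hf
        rwa [lie_toW] at this
      · rw [coeff_sub, coeff_mul_of_eq (a := 0) (b := k) (by simp)
          (fun i hi => by rw [coeff_del]; exact hfi _ (by omega)) (by omega) (by omega),
          coeff_mul_of_lt (a := k + 1) (b := 0) hfi (by simp) (by omega), coeff_del]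
        simp [hu0, hfd]
      · rw [coeff_sub, coeff_mul_of_lt (a := 0) (b := k) (by simp)
          (fun i hi => by rw [coeff_del]; exact hfi _ (by omega)) (by omega),
          coeff_mul_of_lt (a := k + 1) (b := 0) hfi (by simp) (by omega), sub_zero]
  rw [eq_top_iff]
  intro x _
  obtain ⟨f, rfl⟩ := toW_surjective F p n x
  refine mem_of_exists_order (S := U.toSubmodule.comap (toW F p n)) (m := 0) (fun k _ hk => ?_)
    (by simp)
  have := hS (p ^ n - 1 - k) (by omega)
  rwa [show p ^ n - 1 - (p ^ n - 1 - k) = k by omega] at this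

theorem le_W₀_of_isSemiModular (hp : 2 < p) (hn : 0 < n) (hpn : p ^ n ≠ 3)
    {U : LieSubalgebra F (W F p n)} (hU : U.IsSemiModular) (htop : U ≠ ⊤) : U ≤ W₀ F p n := by
  have hq := two_lt_pow p hp hn
  by_contra hle
  obtain ⟨x, hxU, hx⟩ := SetLike.not_le_iff_exists.1 hle
  obtain ⟨u, rfl⟩ := toW_surjective F p n x
  rw [toW_mem_W₀ hq] at hx
  set q := p ^ n with hqdef
  set e := toW F p n (basisElem F q (q - 1)) with he
  have heU : e ∉ U := fun h => htop (eq_top_of_mem U hxU hx h)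
  have hmax : U ⋖ ⊤ := by
    have h := hU.1.covBy_sup_spanSingleton heU
    rwa [eq_top_of_mem (U ⊔ LieSubalgebra.spanSingleton e)
      ((le_sup_left : U ≤ _) hxU) hx ((le_sup_right : LieSubalgebra.spanSingleton e ≤ _)
        (LieSubalgebra.mem_spanSingleton.2 ⟨1, one_smul _ _⟩))] at h
  have hX : ∀ {k : ℕ}, ∀ i < k, (basisElem F q k).coeff i = 0 :=
    fun i hi => coeff_basisElem_of_ne (by omega)
  have hX' : ∀ {k : ℕ}, ∀ i < k - 1, (del F p n (basisElem F q k)).coeff i = 0 := by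
    intro k i hi
    rw [coeff_del]
    exact coeff_basisElem_of_ne (by omega)
  -- Both products have order at least `k + (q - 1) - 1 ≥ q`, so they vanish.
  have hcomm : ∀ k, 2 ≤ k → ⁅toW F p n (basisElem F q k), e⁆ = 0 := by
    intro k hk
    rw [he, lie_toW, show basisElem F q k * del F p n (basisElem F q (q - 1)) -
      basisElem F q (q - 1) * del F p n (basisElem F q k) = 0 from ext_coeff fun i hi => ?_,
      map_zero]
    rw [coeff_sub, coeff_mul_of_lt hX hX' (by omega), coeff_mul_of_lt hX hX' (by omega),
      coeff_zero, sub_zero]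
  obtain ⟨c, hc⟩ := hU.2.exists_add_smul_mem hmax heU (hcomm 2 le_rfl)
  have hodd : Odd q := ((Fact.out : p.Prime).odd_of_ne_two (by omega)).pow
  -- This is where `q ≠ 3` enters: `hcomm` applied to `x^(q-2)` needs `q - 2 ≥ 2`.
  have hq5 : 5 ≤ q := by
    obtain ⟨m, hm⟩ := hodd
    omega
  obtain ⟨d, hd⟩ := hU.2.exists_add_smul_mem hmax heU (hcomm (q - 2) (by omega))
  have hlie := U.lie_mem hc hd
  have hcomm' : ⁅e, toW F p n (basisElem F q (q - 2))⁆ = 0 := by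
    rw [← lie_skew, hcomm _ (by omega), neg_zero]
  rw [add_lie, lie_add, lie_add, lie_smul, hcomm 2 le_rfl, smul_lie, smul_lie, lie_smul, lie_self,
    hcomm', lie_toW] at hlie
  simp only [smul_zero, add_zero] at hlie
  set r : F := (q - 1).choose 2 - (q - 1).choose (q - 2) with hr
  have hval : basisElem F q 2 * del F p n (basisElem F q (q - 2)) -
      basisElem F q (q - 2) * del F p n (basisElem F q 2) = r • basisElem F q (q - 1) := by
    refine ext_coeff fun i hi => ?_
    rw [coeff_sub, coeff_smul]
    rcases Nat.lt_or_ge i (q - 1) with h1 | h1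
    · rw [coeff_mul_of_lt hX hX' (by omega), coeff_mul_of_lt hX hX' (by omega), hX i h1]
      ring
    · obtain rfl : i = q - 1 := by omega
      rw [coeff_mul_of_eq hX hX' (by omega) hi, coeff_mul_of_eq hX hX' (by omega) hi,
        coeff_del, coeff_del, show q - 2 - 1 + 1 = q - 2 by omega, coeff_basisElem_self (by omega),
        coeff_basisElem_self (by omega), coeff_basisElem_self (by omega)]
      ring
  -- As `q = 0` in `F`, the two binomials are `(-1)(-2)/2 = 1` and `-1`, so `r = 2`.
  have hr0 : r ≠ 0 := by
    have hqF : (q : F) = 0 := by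
      rw [hqdef, Nat.cast_pow, CharP.cast_eq_zero, zero_pow hn.ne']
    have h2 : (2 : F) ≠ 0 := by
      intro h
      have : p ∣ 2 := (CharP.cast_eq_zero_iff F p 2).1 (by exact_mod_cast h)
      exact absurd (Nat.le_of_dvd two_pos this) (by omega)
    obtain ⟨m, hm⟩ : ∃ m, q = m + 2 := ⟨q - 2, by omega⟩
    have hmF : (m : F) = -2 := by
      rw [hm] at hqF
      push_cast at hqF
      linear_combination hqF
    have hch : 2 * ((m + 1).choose 2 : F) = (m + 1) * m := by
      have h3 : 2 * (m + 1).choose 2 = (m + 1) * m := by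
        rw [Nat.choose_two_right, Nat.add_sub_cancel]
        exact Nat.mul_div_cancel' (by rw [mul_comm]; exact (Nat.even_mul_succ_self m).two_dvd)
      exact_mod_cast congrArg (Nat.cast : ℕ → F) h3
    have h4 : (2 : F) * r = 2 * 2 := by
      rw [hr, hm, show m + 2 - 1 = m + 1 by omega, show m + 2 - 2 = m by omega,
        Nat.choose_succ_self_right, mul_sub, hch]
      push_cast
      rw [hmF]
      ring
    rw [mul_left_cancel₀ h2 h4]
    exact h2
  rw [hval, map_smul] at hlie
  refine heU ?_
  have := U.smul_mem r⁻¹ hlie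
  rwa [smul_smul, inv_mul_cancel₀ hr0, one_smul] at this

theorem W₀_le_of_isUpperModular (hp : 2 < p) (hn : 0 < n) {U : LieSubalgebra F (W F p n)}
    (hU : U.IsUpperModular) (hbot : U ≠ ⊥) (hle : U ≤ W₀ F p n) : W₀ F p n ≤ U := by
  have hq := two_lt_pow p hp hn
  set q := p ^ n with hqdef
  set S := U.toSubmodule.comap (toW F p n) with hS
  have hS0 : ∀ f ∈ S, f.coeff 0 = 0 := fun f hf => (toW_mem_W₀ hq).1 (hle hf)
  -- The constant term of `f * ∂ g - g * ∂ f` is `-f_1`; adding `f_1 g` cancels it and brings the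
  -- element into `W₀`.
  have hlie : ∀ f ∈ S, ∀ g : TruncDividedPower F q, g.coeff 0 = 1 →
      f * del F p n g - g * del F p n f + f.coeff 1 • g ∈ S := by
    intro f hf g hg
    have hgW : toW F p n g ∉ W₀ F p n := by
      rw [toW_mem_W₀ hq, hg]
      exact one_ne_zero
    set M := U ⊔ LieSubalgebra.spanSingleton (toW F p n g) with hM
    have hgM : toW F p n g ∈ M := (le_sup_right : LieSubalgebra.spanSingleton _ ≤ M)
      (LieSubalgebra.mem_spanSingleton.2 ⟨1, one_smul _ _⟩)
    -- `M` covers `U`, and `M ⊓ W₀` lies between them but misses `g ∂`.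
    have hinf : M ⊓ W₀ F p n = U :=
      ((hU.covBy_sup_spanSingleton fun h => hgW (hle h)).eq_or_eq
        (le_inf le_sup_left hle) inf_le_left).resolve_right
        fun h => hgW (inf_eq_left.1 h hgM)
    have hfM : toW F p n f ∈ M := (le_sup_left : U ≤ M) hf
    change toW F p n _ ∈ U
    rw [← hinf]
    refine ⟨?_, (toW_mem_W₀ hq).2 ?_⟩
    · rw [map_add, map_smul, ← lie_toW]
      exact M.add_mem (M.lie_mem hfM hgM) (M.smul_mem _ hgM)
    · rw [coeff_add, coeff_sub, coeff_smul,
        coeff_mul_of_lt (a := 1) (b := 0) (fun i hi => by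
          rw [Nat.lt_one_iff.1 hi]; exact hS0 f hf) (by simp) (by omega),
        coeff_mul_of_eq (a := 0) (b := 0) (by simp) (by simp) rfl (by omega), coeff_del, hg]
      simp
  have hdel : ∀ f ∈ S, f.coeff 1 = 0 → del F p n f ∈ S := by
    intro f hf hf1
    have h := hlie f hf 1 (by rw [coeff_one (by omega), if_pos rfl])
    rw [hf1, zero_smul, Derivation.map_one_eq_zero, mul_zero, one_mul, add_zero, zero_sub] at h
    simpa using S.neg_mem h
  -- The expression in `hlie` is linear in `g`: subtract its value at `1` from that at `1 + g`.
  have hadd : ∀ f ∈ S, ∀ g : TruncDividedPower F q, g.coeff 0 = 0 →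
      f * del F p n g - g * del F p n f + f.coeff 1 • g ∈ S := by
    intro f hf g hg
    have h1 := hlie f hf 1 (by rw [coeff_one (by omega), if_pos rfl])
    have h2 := hlie f hf (1 + g) (by
      rw [coeff_add, hg, coeff_one (by omega), if_pos rfl, add_zero])
    have h3 := S.sub_mem h2 h1
    rw [map_add, smul_add] at h3
    convert h3 using 1
    ring
  -- If every `f_1` vanished, `S` would be stable under `∂`, which shifts indices down by one. This
  -- contradicts minimality of the least index at which some element of `S` is nonzero.
  have hone : ∃ f ∈ S, f.coeff 1 ≠ 0 := by
    have hex : ∃ m, ∃ f ∈ S, f.coeff m ≠ 0 := by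
      by_contra hcon
      push Not at hcon
      refine hbot (eq_bot_iff.2 fun x hx => ?_)
      obtain ⟨f, rfl⟩ := toW_surjective F p n x
      have : f = 0 := ext_coeff fun i _ => by rw [hcon i f hx, coeff_zero]
      rw [this, map_zero]
      exact zero_mem _
    classical
    obtain ⟨f, hf, hfm⟩ := Nat.find_spec hex
    by_contra hcon
    push Not at hcon
    obtain ⟨k, hk⟩ : ∃ k, Nat.find hex = k + 1 := Nat.exists_eq_succ_of_ne_zero fun h => by
      rw [h] at hfm
      exact hfm (hS0 f hf)
    refine Nat.find_min hex (m := k) (by omega) ⟨_, hdel f hf (hcon f hf), ?_⟩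
    rwa [coeff_del, ← hk]
  obtain ⟨f, hf, hf1⟩ := hone
  have hford : ∀ i < 1, f.coeff i = 0 := fun i hi => by rw [Nat.lt_one_iff.1 hi]; exact hS0 f hf
  -- With `g = x^(k)` in `hadd`, the coefficient at `k` is `k f_1 - f_1 + f_1 = k f_1`.
  have hord : ∀ k, 2 ≤ k → k < q → ¬ p ∣ k → ∃ g ∈ S, g.coeff k ≠ 0 ∧ ∀ i < k, g.coeff i = 0 := by
    intro k hk2 hk hpk
    have hX : ∀ i < k, (basisElem F q k).coeff i = 0 :=
      fun i hi => coeff_basisElem_of_ne (by omega)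
    have hX' : ∀ i < k - 1, (del F p n (basisElem F q k)).coeff i = 0 := by
      intro i hi
      rw [coeff_del]
      exact coeff_basisElem_of_ne (by omega)
    refine ⟨_, hadd f hf (basisElem F q k) (coeff_basisElem_of_ne (by omega)), ?_, fun i hi => ?_⟩
    · rw [coeff_add, coeff_sub, coeff_smul, coeff_mul_of_eq hford hX' (by omega) hk,
        coeff_mul_of_eq (b := 0) hX (by simp) (by omega) hk, coeff_del, coeff_del,
        show k - 1 + 1 = k by omega, coeff_basisElem_self hk, Nat.choose_one_right,
        Nat.choose_self]
      have hkF : (k : F) ≠ 0 := fun h => hpk ((CharP.cast_eq_zero_iff F p k).1 h)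
      simpa using ⟨hkF, hf1⟩
    · rw [coeff_add, coeff_sub, coeff_smul, coeff_mul_of_lt hford hX' (by omega),
        coeff_mul_of_lt (b := 0) hX (by simp) (by omega), hX i hi]
      ring
  intro x hx
  obtain ⟨g, rfl⟩ := toW_surjective F p n x
  rw [toW_mem_W₀ hq] at hx
  refine mem_of_exists_order (S := S) (m := 1) (fun k hk1 hk => ?_)
    (fun i hi => by rw [Nat.lt_one_iff.1 hi, hx])
  rcases hk1.eq_or_lt with rfl | hk2
  · exact ⟨f, hf, hf1, hford⟩
  by_cases hpk : p ∣ k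
  -- For `p ∣ k`, differentiate an element of order `k + 1`; here `k + 1 < q` because `p ∣ q` but `p
  -- ∤ k + 1`.
  · have hpq : p ∣ q := dvd_pow_self p hn.ne'
    have hpk1 : ¬ p ∣ k + 1 := fun h =>
      absurd (Nat.le_of_dvd one_pos ((Nat.dvd_add_right hpk).1 h)) (by omega)
    have hkq : k + 1 ≠ q := fun h => hpk1 (h ▸ hpq)
    obtain ⟨h, hh, hhk, hhi⟩ := hord (k + 1) (by omega) (by omega) hpk1
    refine ⟨_, hdel h hh (hhi 1 (by omega)), by rwa [coeff_del], fun i hi => ?_⟩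
    rw [coeff_del]
    exact hhi _ (by omega)
  · exact hord k hk2 hk hpk

end Zassenhaus

theorem mainTheorem10 {F : Type*} [Field F] [Infinite F] [PerfectField F]
    (p n : ℕ) [Fact p.Prime] [CharP F p] (hp : 2 < p) (hn : 0 < n) (hpn : p ^ n ≠ 3)
    (U : LieSubalgebra F (Zassenhaus.W F p n)) :
    (U ≠ ⊥ ∧ U ≠ ⊤ ∧ U.IsSemiModular) ↔ U = Zassenhaus.W₀ F p n := by
  have hq := Zassenhaus.two_lt_pow p hp hn
  constructor
  · rintro ⟨hbot, htop, hU⟩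
    have hle := Zassenhaus.le_W₀_of_isSemiModular hp hn hpn hU htop
    exact le_antisymm hle (Zassenhaus.W₀_le_of_isUpperModular hp hn hU.1 hbot hle)
  · rintro rfl
    exact ⟨Zassenhaus.W₀_ne_bot hq, Zassenhaus.W₀_ne_top hq, Zassenhaus.W₀_isSemiModular hq⟩
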